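/- A hypergraph $H$ consists of a finite nonempty vertex set and a set of subsets of it, called edges (no multiple edges); let $n_H$ and $m_H$ be the numbers of its vertices and edges. Two distinct vertices are neighbors if some edge contains both. A total transversal of $H$ is a set $T$ of vertices that meets every edge and in which every vertex of $T$ has a neighbor in $T$; $\tau_t(H)$ is the minimum size of a total transversal. For $k \ge 2$ let $\mathcal{H}_k$ be the class of all hypergraphs in which every edge has exactly $k$ vertices, every vertex lies in an edge, and every edge intersects some other edge, and let \[ b_k = \sup_{H \in \mathcal{H}_k} \frac{\tau_t(H)}{n_H + m_H}. \] Then this supremum is over a nonempty set of reals that is bounded above, for every $k \ge 2$, and $b_2 = \frac{2}{5}$, $b_3 = \frac{1}{3}$, $b_4 \le \frac{1}{3}$, and $b_k \le \frac{2}{7}$ for every $k \ge 5$. The value $b_2 = \frac25$ is attained by the path $P_3$ on three vertices, and the value $b_3 = \frac13$ by the hypergraph with four vertices and two edges of size three that intersect in two vertices. -/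

import Mathlib

namespace Hypergraph

variable {α : Type*}

/-- A transversal of `H`: a set of vertices that meets every edge. -/
def IsTransversal (H : Hypergraph α) (T : Set α) : Prop :=
  T ⊆ H.vertexSet ∧ ∀ e ∈ H.edgeSet, (T ∩ e).Nonempty

/-- A total transversal of `H`: a transversal `T` in which every vertex has a neighbor (a different
vertex that shares an edge with it) that lies in `T`. -/
def IsTotalTransversal (H : Hypergraph α) (T : Set α) : Prop :=
  H.IsTransversal T ∧ ∀ x ∈ T, ∃ y ∈ T, y ≠ x ∧ H.Adj x y

/-- The total transversal number: the least number of vertices in a total transversal. -/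
noncomputable def totalTransversalNumber (H : Hypergraph α) : ℕ :=
  sInf {n : ℕ | ∃ T : Finset α, H.IsTotalTransversal (T : Set α) ∧ T.card = n}

/-- The number of vertices. -/
noncomputable def order (H : Hypergraph α) : ℕ := H.vertexSet.ncard

/-- The number of edges. -/
noncomputable def size (H : Hypergraph α) : ℕ := H.edgeSet.ncard

/-- An isolated edge: an edge that intersects no other edge. -/
def IsIsolatedEdge (H : Hypergraph α) (e : Set α) : Prop :=
  e ∈ H.edgeSet ∧ ∀ f ∈ H.edgeSet, f ≠ e → e ∩ f = ∅

/-- The class of finite nonempty `k`-uniform hypergraphs with no isolated vertices and no isolated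
edges. (Multiple edges do not arise, since the edges form a set.) -/
structure InClass (H : Hypergraph α) (k : ℕ) : Prop where
  nonempty : H.vertexSet.Nonempty
  finite : H.vertexSet.Finite
  uniform : ∀ e ∈ H.edgeSet, e.ncard = k
  no_isolated_vertex : ∀ v ∈ H.vertexSet, ¬ H.IsIsolated v
  no_isolated_edge : ∀ e ∈ H.edgeSet, ¬ H.IsIsolatedEdge e

/-- A hypergraph in the class for `k ≥ 2` has a total transversal (the set of all vertices), so the
minimum defining its total transversal number is over a nonempty set. -/
theorem InClass.exists_isTotalTransversal {H : Hypergraph α} {k : ℕ} (h : H.InClass k)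
    (hk : 2 ≤ k) : ∃ T : Finset α, H.IsTotalTransversal (T : Set α) := by
  refine ⟨h.finite.toFinset, ?_⟩
  rw [Set.Finite.coe_toFinset]
  refine ⟨⟨subset_rfl, fun e he => ?_⟩, fun x hx => ?_⟩
  · have hne : e.Nonempty := by
      apply Set.nonempty_of_ncard_ne_zero
      rw [h.uniform e he]
      omega
    obtain ⟨y, hy⟩ := hne
    exact ⟨y, H.subset_vertexSet_of_mem_edgeSet' he hy, hy⟩
  · have hx' := h.no_isolated_vertex x hx
    simp only [IsIsolated, not_forall, not_not] at hx'
    obtain ⟨e, he, hxe⟩ := hx'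
    obtain ⟨y, hy, hyx⟩ := Set.exists_ne_of_one_lt_ncard (s := e) (by rw [h.uniform e he]; omega) x
    exact ⟨y, H.subset_vertexSet_of_mem_edgeSet' he hy, hyx, e, he, hxe, hy⟩

/-- The ratio of the total transversal number to the number of vertices plus edges. -/
noncomputable def totalTransversalRatio (H : Hypergraph α) : ℝ :=
  (H.totalTransversalNumber : ℝ) / ((H.order : ℝ) + (H.size : ℝ))

/-- The ratios attained by the hypergraphs in the class for `k`. Every finite hypergraph is
isomorphic to one whose vertices come from a type in the lowest universe. -/
def ratioSet (k : ℕ) : Set ℝ :=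
  {r : ℝ | ∃ (V : Type) (H : Hypergraph V), H.InClass k ∧ H.totalTransversalRatio = r}

/-- The supremum of the ratios over the class for `k`. -/
noncomputable def b (k : ℕ) : ℝ := sSup (ratioSet k)

/-- The path on three vertices, as a hypergraph. -/
def pathThree : Hypergraph (Fin 3) where
  vertexSet := Set.univ
  edgeSet := {{0, 1}, {1, 2}}
  subset_vertexSet_of_mem_edgeSet' := fun e _ => Set.subset_univ e

/-- The hypergraph with four vertices and two edges of size three that intersect in two vertices. -/
def twoTriples : Hypergraph (Fin 4) where
  vertexSet := Set.univ
  edgeSet := {{0, 1, 2}, {1, 2, 3}}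
  subset_vertexSet_of_mem_edgeSet' := fun e _ => Set.subset_univ e

end Hypergraph

/-!
The bounds come from a greedy selection on families `F` of finite edges, with a potential equal to
the number of vertices plus the number of edges. A total transversal is built up by selections: a
selected vertex must have a selected neighbor. After a selection, the edges that were hit and the
vertices that lie in no remaining edge disappear, and the neighbors of the selection become red: they
may be selected later at no further condition. An edge that the deletion isolates met an edge that
was hit, so it contains a red vertex; hence the condition `Admissible`, that each edge has a red
vertex or meets another edge, is preserved (`Admissible.missed`). If a selection of `s` vertices
makes `g` vertices and edges disappear, with `a * s ≤ b * g`, then induction applies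
(`exists_covers_of_gains`); what remains are the families in which no cheap selection pays.

The basic selection is a vertex `x` of degree `d ≥ 2` with a neighbor; it can be chosen to gain
`d + 3` (`exists_gains_of_two_le`). Moreover one vertex per edge always suffices
(`exists_covers_card_le`), so after any selection `S` the total cost is at most `#S` plus the number
of missed edges.

* Edge size at least 2, factor `2 / 5`: degrees are at most one, and one vertex per edge is enough.
* Edge size at least 3, factor `1 / 3`: degrees are at most two, and two edges share at most one
  vertex. Select disjointly as many pairs hitting three edges as possible, in total a set `S` hitting
  `h ≥ 3 * #S / 2` edges and missing `u`. Each missed edge then has at most one vertex in common with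
  other missed edges, so there are at least `#S + 5 * u / 2` vertices, and at least `3 * (h + u) / 2`
  since all degrees are at most two. The mean of these two bounds is what is needed for
  `3 * (#S + u)`.
* Edge size at least 5, factor `2 / 7`: degrees are at most three, and two vertices of degree three
  that share an edge share at least two. Let `c` be the number of vertices of degree three. If all
  edges had size 5, then `5 * m ≤ 2 * n + c`, so it suffices to save `c / 7` vertices compared with
  one per edge. Each member of a maximal set of vertices of degree three with disjoint stars saves
  one, and shares an edge with at most six other vertices of degree three, as each uses two of the
  twelve other places in its three edges. Larger edges pay for the additional places.

Working with lower bounds on edge sizes gives the case of size 4 from that of size 3.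
-/

namespace EdgeFamily

open Finset

variable {α : Type*}

/-! ### Selecting vertices -/

/-- Two vertices are joined if they are different and share an edge of `F`. -/
def Joined (F : Finset (Finset α)) (x y : α) : Prop := y ≠ x ∧ ∃ e ∈ F, x ∈ e ∧ y ∈ e

lemma Joined.mono {F G : Finset (Finset α)} {x y : α} (h : Joined F x y)
    (hFG : F ⊆ G) : Joined G x y :=
  ⟨h.1, h.2.imp fun _ he => ⟨hFG he.1, he.2⟩⟩

lemma Joined.symm {F : Finset (Finset α)} {x y : α} (h : Joined F x y) : Joined F y x :=
  ⟨h.1.symm, h.2.imp fun _ he => ⟨he.1, he.2.2, he.2.1⟩⟩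

variable [DecidableEq α]

/-- The vertices covered by a family of edges. -/
def support (F : Finset (Finset α)) : Finset α := F.biUnion id

/-- The edges of `F` that contain the vertex `x`; their number is the degree of `x`. -/
def star (F : Finset (Finset α)) (x : α) : Finset (Finset α) := {e ∈ F | x ∈ e}

/-- The edges of `F` that contain a vertex of `S`. -/
def hit (F : Finset (Finset α)) (S : Finset α) : Finset (Finset α) := {e ∈ F | ¬ Disjoint e S}

/-- The edges of `F` that avoid `S`. -/
def missed (F : Finset (Finset α)) (S : Finset α) : Finset (Finset α) := {e ∈ F | Disjoint e S}

/-- Every vertex of `S` is red or has a neighbor in `S`. -/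
def Anchored (F : Finset (Finset α)) (R : Set α) (S : Finset α) : Prop :=
  ∀ x ∈ S, x ∈ R ∨ ∃ y ∈ S, Joined F x y

/-- Every edge of `F` contains a red vertex or meets another edge of `F`. -/
def Admissible (F : Finset (Finset α)) (R : Set α) : Prop :=
  ∀ e ∈ F, (∃ x ∈ e, x ∈ R) ∨ ∃ f ∈ F, f ≠ e ∧ ∃ x ∈ e, x ∈ f

/-- A total transversal of `F` relative to a set `R` of red vertices: red vertices need no neighbor
in it. -/
def Covers (F : Finset (Finset α)) (R : Set α) (T : Finset α) : Prop :=
  (∀ e ∈ F, ¬ Disjoint e T) ∧ Anchored F R T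

/-- The red vertices after `S` has been selected: the old ones and the neighbors of `S`. -/
def redAfter (F : Finset (Finset α)) (R : Set α) (S : Finset α) : Set α :=
  R ∪ {x | ∃ y ∈ S, Joined F x y}

variable {F : Finset (Finset α)} {R : Set α} {S T : Finset α} {x y z : α} {e f : Finset α}

lemma mem_support : x ∈ support F ↔ ∃ e ∈ F, x ∈ e := by simp [support]

lemma mem_star : e ∈ star F x ↔ e ∈ F ∧ x ∈ e := by simp [star]

lemma mem_hit : e ∈ hit F S ↔ e ∈ F ∧ ¬ Disjoint e S := by simp [hit]

lemma mem_missed : e ∈ missed F S ↔ e ∈ F ∧ Disjoint e S := by simp [missed]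

lemma missed_subset : missed F S ⊆ F := filter_subset _ _

lemma star_subset : star F x ⊆ F := filter_subset _ _

lemma star_subset_hit (hx : x ∈ S) : star F x ⊆ hit F S := by
  intro e he
  rw [mem_star] at he
  exact mem_hit.2 ⟨he.1, not_disjoint_iff.2 ⟨x, he.2, hx⟩⟩

lemma card_hit_add_card_missed (F : Finset (Finset α)) (S : Finset α) :
    #(hit F S) + #(missed F S) = #F := by
  rw [add_comm]
  exact card_filter_add_card_filter_not _

lemma Admissible.missed (h : Admissible F R) (S : Finset α) :
    Admissible (missed F S) (redAfter F R S) := by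
  intro e he
  obtain ⟨heF, hd⟩ := mem_missed.1 he
  obtain ⟨x, hx, hR⟩ | ⟨f, hf, hne, x, hx, hxf⟩ := h e heF
  · exact Or.inl ⟨x, hx, Or.inl hR⟩
  · by_cases hfS : Disjoint f S
    · exact Or.inr ⟨f, mem_missed.2 ⟨hf, hfS⟩, hne, x, hx, hxf⟩
    · obtain ⟨y, hyf, hyS⟩ := not_disjoint_iff.1 hfS
      refine Or.inl ⟨x, hx, Or.inr ⟨y, hyS, ?_, f, hf, hxf, hyf⟩⟩
      rintro rfl
      exact disjoint_left.1 hd hx hyS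

/-- A selection is completed by a total transversal of the missed edges, in which the neighbors of
the selection count as red. -/
lemma Anchored.covers_union (hS : Anchored F R S) (hT : Covers (missed F S) (redAfter F R S) T) :
    Covers F R (S ∪ T) := by
  refine ⟨fun e he => ?_, fun x hx => ?_⟩
  · rw [disjoint_union_right, not_and]
    exact fun hd => hT.1 e (mem_missed.2 ⟨he, hd⟩)
  · rcases mem_union.1 hx with hx | hx
    · exact (hS x hx).imp_right fun ⟨y, hy, h⟩ => ⟨y, mem_union_left _ hy, h⟩
    · rcases hT.2 x hx with (hR | ⟨y, hy, h⟩) | ⟨y, hy, h⟩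
      · exact Or.inl hR
      · exact Or.inr ⟨y, mem_union_left _ hy, h⟩
      · exact Or.inr ⟨y, mem_union_right _ hy, h.mono missed_subset⟩

lemma anchored_pair (h : Joined F x y) : Anchored F R {x, y} := by
  intro z hz
  rcases mem_insert.1 hz with rfl | hz
  · exact Or.inr ⟨y, by simp, h⟩
  · rw [mem_singleton] at hz
    subst hz
    exact Or.inr ⟨x, by simp, h.symm⟩

/-- Selecting `S` removes the vertices of `W` if all their edges are hit. -/
lemma card_support_missed_add_le {W : Finset α} (hW : W ⊆ support F)
    (hS : ∀ w ∈ W, star F w ⊆ hit F S) : #(support (missed F S)) + #W ≤ #(support F) := by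
  rw [← card_union_of_disjoint]
  · refine card_le_card (union_subset (biUnion_subset_biUnion_of_subset_left _ missed_subset) hW)
  · rw [disjoint_left]
    intro w hw hwW
    obtain ⟨e, he, hwe⟩ := mem_support.1 hw
    obtain ⟨heF, hd⟩ := mem_missed.1 he
    exact (mem_hit.1 (hS w hwW (mem_star.2 ⟨heF, hwe⟩))).2 hd

/-- `S` is an anchored selection that hits some edge and lowers the number of vertices and edges
by at least `g`. -/
def Gains (F : Finset (Finset α)) (R : Set α) (S : Finset α) (g : ℕ) : Prop :=
  Anchored F R S ∧ (hit F S).Nonempty ∧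
    #(support (missed F S)) + #(missed F S) + g ≤ #(support F) + #F

lemma Gains.of_subset {W : Finset α} {D : Finset (Finset α)} (hS : Anchored F R S)
    (hW : W ⊆ support F) (hWS : ∀ w ∈ W, star F w ⊆ hit F S) (hD : D ⊆ hit F S)
    (hne : D.Nonempty) : Gains F R S (#W + #D) := by
  refine ⟨hS, hne.mono hD, ?_⟩
  have h1 := card_support_missed_add_le hW hWS
  have h2 := card_hit_add_card_missed F S
  have h3 := card_le_card hD
  omega

lemma Gains.mono {g g' : ℕ} (h : Gains F R S g) (hg : g' ≤ g) : Gains F R S g' :=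
  ⟨h.1, h.2.1, by have := h.2.2; omega⟩

/-- The greedy induction: a bound on total transversals may be proved under the assumption that
no selection pays for itself. -/
theorem exists_covers_of_gains {a b k : ℕ}
    (h : ∀ (F : Finset (Finset α)) (R : Set α), (∀ e ∈ F, k ≤ #e) → Admissible F R →
      (∃ S g, Gains F R S g ∧ a * #S ≤ b * g) ∨
      ∃ T, Covers F R T ∧ a * #T ≤ b * (#(support F) + #F))
    (F : Finset (Finset α)) (R : Set α) (hk : ∀ e ∈ F, k ≤ #e) (hF : Admissible F R) :
    ∃ T, Covers F R T ∧ a * #T ≤ b * (#(support F) + #F) := by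
  induction hm : #F using Nat.strong_induction_on generalizing F R with
  | _ m ih =>
    subst hm
    obtain ⟨S, g, hS, hg⟩ | hT := h F R hk hF
    · have hlt : #(missed F S) < #F := by
        have h1 := card_hit_add_card_missed F S
        have h2 := hS.2.1.card_pos
        omega
      obtain ⟨T, hT, hTc⟩ := ih _ hlt (missed F S) (redAfter F R S)
        (fun e he => hk e (missed_subset he)) (hF.missed S) rfl
      refine ⟨S ∪ T, hS.1.covers_union hT, ?_⟩
      calc a * #(S ∪ T) ≤ a * (#S + #T) := Nat.mul_le_mul_left _ (card_union_le _ _)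
        _ = a * #S + a * #T := mul_add _ _ _
        _ ≤ b * g + b * (#(support (missed F S)) + #(missed F S)) := add_le_add hg hTc
        _ = b * (#(support (missed F S)) + #(missed F S) + g) := by ring
        _ ≤ _ := Nat.mul_le_mul_left _ hS.2.2
    · exact hT

/-- A vertex of degree at least two can be selected together with a neighbor so that its edges and
three more vertices or edges disappear: either the neighbor hits one more edge, or all vertices of
these edges (at least three) disappear. -/
lemma exists_gains_of_two_le (hk : ∀ e ∈ F, 2 ≤ #e) (hx : 2 ≤ #(star F x)) :
    ∃ y, Joined F x y ∧ Gains F R {x, y} (#(star F x) + 3) := by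
  by_cases h : ∃ y, Joined F x y ∧ ∃ f ∈ star F y, f ∉ star F x
  · obtain ⟨y, hxy, f, hf, hfx⟩ := h
    refine ⟨y, hxy, ?_⟩
    obtain ⟨hne, e, he, hxe, hye⟩ := hxy
    have := Gains.of_subset (F := F) (R := R) (S := {x, y}) (W := {x, y})
      (D := insert f (star F x)) (anchored_pair ⟨hne, e, he, hxe, hye⟩)
      (by
        intro w hw
        rw [mem_support]
        exact ⟨e, he, by grind⟩)
      (fun w hw => star_subset_hit hw)
      (insert_subset (star_subset_hit (by simp) hf) (star_subset_hit (by simp)))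
      (insert_nonempty _ _)
    rw [card_pair hne.symm, card_insert_of_notMem hfx] at this
    exact this.mono (by omega)
  · -- all edges of the neighbors of `x` contain `x`, so any neighbor will do
    push Not at h
    obtain ⟨e, he, f, hf, hef⟩ := one_lt_card.1 hx
    rw [mem_star] at he hf
    obtain ⟨y, hye, hyx⟩ := exists_mem_ne (hk e he.1) x
    have hxy : Joined F x y := ⟨hyx, e, he.1, he.2, hye⟩
    refine ⟨y, hxy, ?_⟩
    have h3 : 3 ≤ #(support (star F x)) := by
      have h1 : e ⊆ support (star F x) := fun z hz => mem_support.2 ⟨e, mem_star.2 he, hz⟩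
      have h2 : f ⊆ support (star F x) := fun z hz => mem_support.2 ⟨f, mem_star.2 hf, hz⟩
      by_contra hlt
      have h3 := hk e he.1
      have h4 := hk f hf.1
      exact hef ((eq_of_subset_of_card_le h1 (by omega)).trans
        (eq_of_subset_of_card_le h2 (by omega)).symm)
    have := Gains.of_subset (F := F) (R := R) (S := {x, y}) (W := support (star F x))
      (D := star F x) (anchored_pair hxy)
      (biUnion_subset_biUnion_of_subset_left _ star_subset)
      (by
        intro w hw
        obtain ⟨g, hg, hwg⟩ := mem_support.1 hw
        rw [mem_star] at hg
        by_cases hwx : w = x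
        · subst hwx
          exact star_subset_hit (by simp)
        · exact fun e' he' => star_subset_hit (by simp) (h w ⟨hwx, g, hg.1, hg.2, hwg⟩ e' he'))
      (star_subset_hit (by simp)) ⟨e, mem_star.2 he⟩
    exact this.mono (by omega)

/-- One vertex per edge suffices: select adjacent pairs of which one vertex lies in two edges, and
when no edges meet any more, a red vertex of each edge. -/
theorem exists_covers_card_le (F : Finset (Finset α)) (R : Set α) (hk : ∀ e ∈ F, 2 ≤ #e)
    (hF : Admissible F R) : ∃ T, Covers F R T ∧ #T ≤ #F := by
  induction hm : #F using Nat.strong_induction_on generalizing F R with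
  | _ m ih =>
    subst hm
    have key : ∀ S, Anchored F R S → S.Nonempty → #S ≤ #(hit F S) →
        ∃ T, Covers F R T ∧ #T ≤ #F := by
      intro S hS hne hc
      have h1 := card_hit_add_card_missed F S
      have h2 := hne.card_pos
      obtain ⟨T, hT, hTc⟩ := ih _ (by omega) (missed F S) (redAfter F R S)
        (fun e he => hk e (missed_subset he)) (hF.missed S) rfl
      exact ⟨S ∪ T, hS.covers_union hT, (card_union_le _ _).trans (by omega)⟩
    rcases F.eq_empty_or_nonempty with rfl | ⟨e, he⟩
    · exact ⟨∅, ⟨by simp, by simp [Anchored]⟩, by simp⟩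
    obtain ⟨x, hx, hR⟩ | ⟨f, hf, hne, x, hx, hxf⟩ := hF e he
    · refine key {x} (fun z hz => ?_) (singleton_nonempty x) ?_
      · rw [mem_singleton] at hz
        exact Or.inl (hz ▸ hR)
      · rw [card_singleton, Nat.one_le_iff_ne_zero, ← Nat.pos_iff_ne_zero, card_pos]
        exact ⟨e, star_subset_hit (by simp) (mem_star.2 ⟨he, hx⟩)⟩
    · obtain ⟨y, hye, hyx⟩ := exists_mem_ne (hk e he) x
      refine key {x, y} (anchored_pair ⟨hyx, e, he, hx, hye⟩) (insert_nonempty _ _) ?_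
      rw [card_pair hyx.symm, ← card_pair hne]
      exact card_le_card (insert_subset (star_subset_hit (by simp) (mem_star.2 ⟨hf, hxf⟩))
        (singleton_subset_iff.2 (star_subset_hit (by simp) (mem_star.2 ⟨he, hx⟩))))

/-- A selection `S` can be completed by one vertex for each missed edge. -/
lemma Anchored.exists_covers (hk : ∀ e ∈ F, 2 ≤ #e) (hF : Admissible F R) (hS : Anchored F R S) :
    ∃ T, Covers F R T ∧ #T ≤ #S + #(missed F S) := by
  obtain ⟨T, hT, hTc⟩ := exists_covers_card_le (missed F S) (redAfter F R S)
    (fun e he => hk e (missed_subset he)) (hF.missed S)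
  exact ⟨S ∪ T, hS.covers_union hT, (card_union_le _ _).trans (by omega)⟩

/-! ### Counting incidences -/

/-- Double counting of the incidences between a family of edges and a set of vertices. -/
lemma sum_card_inter_eq_sum_card_star (F : Finset (Finset α)) (A : Finset α) :
    ∑ e ∈ F, #(A ∩ e) = ∑ x ∈ A, #(star F x) := by
  have := sum_card_bipartiteAbove_eq_sum_card_bipartiteBelow (s := A) (t := F)
    (fun (x : α) (e : Finset α) => x ∈ e)
  rw [show ∑ x ∈ A, #(star F x) = _ from this]
  exact sum_congr rfl fun e _ => by rw [bipartiteBelow, filter_mem_eq_inter]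

lemma sum_card_eq_sum_card_star (F : Finset (Finset α)) :
    ∑ e ∈ F, #e = ∑ x ∈ support F, #(star F x) := by
  rw [← sum_card_inter_eq_sum_card_star]
  refine sum_congr rfl fun e he => ?_
  rw [inter_eq_right.2 (fun z hz => mem_support.2 ⟨e, he, hz⟩)]

/-! ### Edges of size at least two -/

theorem exists_covers_two (F : Finset (Finset α)) (R : Set α) (hk : ∀ e ∈ F, 2 ≤ #e)
    (hF : Admissible F R) : ∃ T, Covers F R T ∧ 5 * #T ≤ 2 * (#(support F) + #F) := by
  refine exists_covers_of_gains (k := 2) (fun F R hk hF => ?_) F R hk hF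
  by_cases hd : ∃ x, 2 ≤ #(star F x)
  · obtain ⟨x, hx⟩ := hd
    obtain ⟨y, hxy, hg⟩ := exists_gains_of_two_le (R := R) hk hx
    refine Or.inl ⟨_, _, hg, ?_⟩
    rw [card_pair hxy.1.symm]
    omega
  · right
    push Not at hd
    obtain ⟨T, hT, hc⟩ := exists_covers_card_le F R hk hF
    refine ⟨T, hT, ?_⟩
    have h1 := sum_card_eq_sum_card_star F
    have h2 : ∑ x ∈ support F, #(star F x) ≤ #(support F) • 1 :=
      sum_le_card_nsmul _ _ _ fun x _ => Nat.le_of_lt_succ (hd x)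
    have h3 : #F • 2 ≤ ∑ e ∈ F, #e := card_nsmul_le_sum _ _ _ hk
    simp only [smul_eq_mul] at h2 h3
    omega


/-! ### Edges of size at least three -/

/-- If all degrees are at most two, two edges with two common vertices can be hit by two vertices
so that six vertices or edges disappear. -/
lemma exists_gains_of_two_common (hd : ∀ x, #(star F x) ≤ 2) (hk : ∀ e ∈ F, 3 ≤ #e)
    (he : e ∈ F) (hf : f ∈ F) (hef : e ≠ f) (hyz : y ≠ z) (hye : y ∈ e) (hyf : y ∈ f)
    (hze : z ∈ e) (hzf : z ∈ f) : ∃ w, Joined F y w ∧ Gains F R {y, w} 6 := by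
  have hstar : ∀ w, w ∈ e → w ∈ f → star F w = {e, f} := fun w hwe hwf =>
    (eq_of_subset_of_card_le (insert_subset (mem_star.2 ⟨he, hwe⟩)
      (singleton_subset_iff.2 (mem_star.2 ⟨hf, hwf⟩))) (by rw [card_pair hef]; exact hd w)).symm
  have hy := hstar y hye hyf
  have hz := hstar z hze hzf
  -- a third edge at a vertex `w` is hit by `w`, and `z` disappears together with `y` and `w`
  by_cases h : ∃ w ∈ e ∪ f, ∃ g ∈ star F w, g ≠ e ∧ g ≠ f
  · obtain ⟨w, hw, g, hg, hge, hgf⟩ := h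
    have hwy : w ≠ y := by
      rintro rfl
      rw [hy] at hg
      grind
    have hwz : w ≠ z := by
      rintro rfl
      rw [hz] at hg
      grind
    have hyw : Joined F y w := by
      rcases mem_union.1 hw with hw | hw
      · exact ⟨hwy, e, he, hye, hw⟩
      · exact ⟨hwy, f, hf, hyf, hw⟩
    refine ⟨w, hyw, ?_⟩
    have hD : star F y ⊆ hit F {y, w} := star_subset_hit (by simp)
    have := Gains.of_subset (R := R) (W := {y, w, z}) (D := insert g (star F y))
      (anchored_pair hyw)
      (by
        intro v hv
        rw [mem_support]
        simp only [mem_insert, mem_singleton] at hv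
        rcases hv with rfl | rfl | rfl
        · exact ⟨e, he, hye⟩
        · exact ⟨g, mem_star.1 hg⟩
        · exact ⟨e, he, hze⟩)
      (by
        intro v hv
        simp only [mem_insert, mem_singleton] at hv
        rcases hv with rfl | rfl | rfl
        · exact hD
        · exact star_subset_hit (by simp)
        · rw [hz, ← hy]
          exact hD)
      (insert_subset (star_subset_hit (by simp) hg) hD) (insert_nonempty _ _)
    have h3 : #({y, w, z} : Finset α) = 3 := card_eq_three.2 ⟨y, w, z, hwy.symm, hyz, hwz, rfl⟩
    have h4 : #(insert g (star F y)) = 3 := by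
      rw [hy]
      exact card_eq_three.2 ⟨g, e, f, hge, hgf, hef, rfl⟩
    rwa [h3, h4] at this
  · -- no other edge meets `e` or `f`, so all their vertices disappear
    push Not at h
    have hyw : Joined F y z := ⟨hyz.symm, e, he, hye, hze⟩
    refine ⟨z, hyw, ?_⟩
    have hD : star F y ⊆ hit F {y, z} := star_subset_hit (by simp)
    have := Gains.of_subset (R := R) (W := e ∪ f) (D := star F y) (anchored_pair hyw)
      (by
        intro v hv
        rw [mem_support]
        exact (mem_union.1 hv).elim (fun h => ⟨e, he, h⟩) (fun h => ⟨f, hf, h⟩))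
      (by
        intro v hv g hg
        refine hD ?_
        rw [hy]
        have := h v hv g hg
        grind)
      hD ⟨e, mem_star.2 ⟨he, hye⟩⟩
    have h3 := hk e he
    have h4 := hk f hf
    have h5 : 4 ≤ #(e ∪ f) := by
      by_contra hlt
      have h1 : e ⊆ e ∪ f := subset_union_left
      have h2 : f ⊆ e ∪ f := subset_union_right
      exact hef ((eq_of_subset_of_card_le h1 (by omega)).trans
        (eq_of_subset_of_card_le h2 (by omega)).symm)
    rw [hy, card_pair hef] at this
    exact this.mono (by omega)

/-- A set of pairs of joined vertices, each pair hitting three new edges, that cannot be enlarged.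
Only the consequence `3 * #S ≤ 2 * #(hit F S)` of this description is recorded, and `S` is taken of
maximal size with it. The absence of red vertices (`∅`) forces every member to have its neighbor
inside `S`. -/
lemma exists_maximal_selection (F : Finset (Finset α)) :
    ∃ S, Anchored F ∅ S ∧ S ⊆ support F ∧ 3 * #S ≤ 2 * #(hit F S) ∧
      ∀ x y, Joined (missed F S) x y → #(hit (missed F S) {x, y}) ≤ 2 := by
  classical
  let P : Finset (Finset α) :=
    {S ∈ (support F).powerset | Anchored F ∅ S ∧ 3 * #S ≤ 2 * #(hit F S)}
  have hP : P.Nonempty := ⟨∅, by simp [P, Anchored]⟩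
  obtain ⟨S, hS, hmax⟩ := exists_max_image P card hP
  obtain ⟨hS1, hS2, hS3⟩ : S ⊆ support F ∧ Anchored F ∅ S ∧ 3 * #S ≤ 2 * #(hit F S) := by
    simpa [P] using hS
  refine ⟨S, hS2, hS1, hS3, fun x y hxy => ?_⟩
  by_contra! hlt
  have hxy' := hxy.mono missed_subset
  obtain ⟨hne, e, he, hxe, hye⟩ := hxy
  obtain ⟨heF, hd⟩ := mem_missed.1 he
  have hxS : x ∉ S := disjoint_left.1 hd hxe
  have hyS : y ∉ S := disjoint_left.1 hd hye
  have hcard : #(S ∪ {x, y}) = #S + 2 := by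
    rw [card_union_of_disjoint (by simp [hxS, hyS]), card_pair hne.symm]
  have hhit : #(hit F S) + #(hit (missed F S) {x, y}) ≤ #(hit F (S ∪ {x, y})) := by
    rw [← card_union_of_disjoint]
    · refine card_le_card fun g hg => ?_
      simp only [mem_union, mem_hit, mem_missed, disjoint_union_right] at hg ⊢
      tauto
    · rw [disjoint_left]
      intro g hg hg'
      exact (mem_hit.1 hg).2 (mem_missed.1 (mem_hit.1 hg').1).2
  have hmem : S ∪ {x, y} ∈ P := by
    simp only [P, mem_filter, mem_powerset]
    refine ⟨union_subset hS1 ?_, fun v hv => ?_, by omega⟩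
    · intro v hv
      exact mem_support.2 ⟨e, heF, by grind⟩
    · rcases mem_union.1 hv with hv | hv
      · exact (hS2 v hv).imp_right fun ⟨w, hw, h⟩ => ⟨w, mem_union_left _ hw, h⟩
      · exact (anchored_pair hxy' v hv).imp_right fun ⟨w, hw, h⟩ => ⟨w, mem_union_right _ hw, h⟩
  have := hmax _ hmem
  omega

/-- The remaining case for edges of size at least three: degrees are at most two and any two edges
share at most one vertex. -/
lemma exists_covers_three_of_linear (hk : ∀ e ∈ F, 3 ≤ #e) (hF : Admissible F R)
    (hd : ∀ x, #(star F x) ≤ 2)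
    (hl : ∀ e ∈ F, ∀ f ∈ F, e ≠ f → ∀ y z, y ∈ e → y ∈ f → z ∈ e → z ∈ f → y = z) :
    ∃ T, Covers F R T ∧ 3 * #T ≤ #(support F) + #F := by
  obtain ⟨S, hS, hSF, hSc, hmax⟩ := exists_maximal_selection F
  have hS' : Anchored F R S := fun x hx => (hS x hx).imp_left fun h => h.elim
  obtain ⟨T, hT, hTc⟩ := hS'.exists_covers (fun e he => (hk e he).trans' (by norm_num)) hF
  refine ⟨T, hT, ?_⟩
  have hm := card_hit_add_card_missed F S
  have hn := card_support_missed_add_le hSF (fun w hw => star_subset_hit hw)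
  set U := missed F S
  have hUF : U ⊆ F := missed_subset
  -- every edge is counted at least three times, every vertex at most twice
  have hn' : 3 * #F ≤ 2 * #(support F) := by
    have h1 := sum_card_eq_sum_card_star F
    have h2 : ∑ x ∈ support F, #(star F x) ≤ #(support F) • 2 :=
      sum_le_card_nsmul _ _ _ fun x _ => hd x
    have h3 : #F • 3 ≤ ∑ e ∈ F, #e := card_nsmul_le_sum _ _ _ hk
    simp only [smul_eq_mul] at h2 h3
    omega
  -- by maximality, each missed edge has at most one vertex in another missed edge
  have hU5 : 5 * #U ≤ 2 * #(support U) := by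
    let A : Finset α := {x ∈ support U | 2 ≤ #(star U x)}
    have h1 := sum_card_eq_sum_card_star U
    have h2 : #U • 3 ≤ ∑ e ∈ U, #e := card_nsmul_le_sum _ _ _ fun e he => hk e (hUF he)
    have h3 : ∑ x ∈ support U, #(star U x) ≤ #(support U) + #A := by
      rw [card_filter, card_eq_sum_ones, ← sum_add_distrib]
      refine sum_le_sum fun x _ => ?_
      have : #(star U x) ≤ #(star F x) := card_le_card (filter_subset_filter _ hUF)
      have := hd x
      split_ifs <;> omega
    have h4 : #A • 2 ≤ ∑ x ∈ A, #(star U x) :=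
      card_nsmul_le_sum _ _ _ fun x hx => (mem_filter.1 hx).2
    have h5 : ∑ e ∈ U, #(A ∩ e) ≤ #U • 1 := by
      refine sum_le_card_nsmul _ _ _ fun e he => card_le_one.2 fun x hx y hy => ?_
      by_contra hne
      obtain ⟨hxA, hxe⟩ := mem_inter.1 hx
      obtain ⟨hyA, hye⟩ := mem_inter.1 hy
      obtain ⟨f, hf, hfe⟩ := exists_mem_ne (mem_filter.1 hxA).2 e
      obtain ⟨g, hg, hge⟩ := exists_mem_ne (mem_filter.1 hyA).2 e
      obtain ⟨hfU, hxf⟩ := mem_star.1 hf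
      obtain ⟨hgU, hyg⟩ := mem_star.1 hg
      have hfg : f ≠ g := by
        rintro rfl
        exact hne (hl e (hUF he) f (hUF hfU) hfe.symm x y hxe hxf hye hyg)
      have h6 := hmax x y ⟨Ne.symm hne, e, he, hxe, hye⟩
      have h7 : ({e, f, g} : Finset (Finset α)) ⊆ hit U {x, y} := by
        intro p hp
        simp only [mem_insert, mem_singleton] at hp
        rcases hp with rfl | rfl | rfl
        · exact star_subset_hit (x := x) (by simp) (mem_star.2 ⟨he, hxe⟩)
        · exact star_subset_hit (x := x) (by simp) hf
        · exact star_subset_hit (x := y) (by simp) hg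
      have h8 := card_le_card h7
      rw [card_eq_three.2 ⟨e, f, g, hfe.symm, hge.symm, hfg, rfl⟩] at h8
      omega
    rw [sum_card_inter_eq_sum_card_star] at h5
    simp only [smul_eq_mul] at h2 h4 h5
    omega
  omega

theorem exists_covers_three (F : Finset (Finset α)) (R : Set α) (hk : ∀ e ∈ F, 3 ≤ #e)
    (hF : Admissible F R) : ∃ T, Covers F R T ∧ 3 * #T ≤ 1 * (#(support F) + #F) := by
  refine exists_covers_of_gains (k := 3) (fun F R hk hF => ?_) F R hk hF
  by_cases hd : ∃ x, 3 ≤ #(star F x)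
  · obtain ⟨x, hx⟩ := hd
    obtain ⟨y, hxy, hg⟩ := exists_gains_of_two_le (R := R) (x := x)
      (fun e he => (hk e he).trans' (by norm_num)) (by omega)
    refine Or.inl ⟨_, _, hg, ?_⟩
    rw [card_pair hxy.1.symm]
    omega
  push Not at hd
  have hd' : ∀ x, #(star F x) ≤ 2 := fun x => Nat.le_of_lt_succ (hd x)
  by_cases hl : ∀ e ∈ F, ∀ f ∈ F, e ≠ f → ∀ y z, y ∈ e → y ∈ f → z ∈ e → z ∈ f → y = z
  · obtain ⟨T, hT, hc⟩ := exists_covers_three_of_linear hk hF hd' hl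
    exact Or.inr ⟨T, hT, by omega⟩
  · push Not at hl
    obtain ⟨e, he, f, hf, hef, y, z, hye, hyf, hze, hzf, hyz⟩ := hl
    obtain ⟨w, hyw, hg⟩ :=
      exists_gains_of_two_common (R := R) hd' hk he hf hef hyz hye hyf hze hzf
    refine Or.inl ⟨_, _, hg, ?_⟩
    rw [card_pair hyw.1.symm]


/-! ### Edges of size at least five -/

/-- Two vertices of degree three with exactly one common edge hit five edges. -/
lemma gains_of_card_inter_eq_one (hy : #(star F y) = 3) (hz : #(star F z) = 3)
    (hyz : #(star F y ∩ star F z) = 1) : Joined F y z ∧ Gains F R {y, z} 7 := by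
  obtain ⟨e, he⟩ := card_pos.1 (hyz ▸ Nat.one_pos)
  obtain ⟨hey, hez⟩ := mem_inter.1 he
  have hne : y ≠ z := by
    rintro rfl
    rw [inter_self] at hyz
    omega
  have hj : Joined F y z := ⟨hne.symm, e, (mem_star.1 hey).1, (mem_star.1 hey).2, (mem_star.1 hez).2⟩
  refine ⟨hj, ?_⟩
  have := Gains.of_subset (R := R) (W := {y, z}) (D := star F y ∪ star F z) (anchored_pair hj)
    (by
      intro v hv
      have h1 := mem_star.1 hey
      have h2 := mem_star.1 hez
      exact mem_support.2 ⟨e, h1.1, by grind⟩)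
    (fun w hw => star_subset_hit hw)
    (union_subset (star_subset_hit (by simp)) (star_subset_hit (by simp)))
    ⟨e, mem_union_left _ hey⟩
  have h := card_union_add_card_inter (star F y) (star F z)
  rw [card_pair hne] at this
  exact this.mono (by omega)

/-- The vertices of degree three. -/
def cubic (F : Finset (Finset α)) : Finset α := {x ∈ support F | #(star F x) = 3}

lemma mem_cubic : x ∈ cubic F ↔ #(star F x) = 3 := by
  refine ⟨fun h => (mem_filter.1 h).2, fun h => mem_filter.2 ⟨?_, h⟩⟩
  obtain ⟨e, he⟩ : (star F x).Nonempty := card_pos.1 (by omega)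
  exact mem_support.2 ⟨e, mem_star.1 he⟩

/-- If vertices of degree three that share an edge share at least two edges, then the number of
those sharing an edge with a given one `y` is bounded by the sizes of the three edges at `y`. -/
lemma two_mul_card_cubic_near_add_one_le (hy : y ∈ cubic F)
    (h2 : ∀ y ∈ cubic F, ∀ z ∈ cubic F, ¬ Disjoint (star F z) (star F y) →
      2 ≤ #(star F y ∩ star F z)) :
    2 * #{z ∈ cubic F | ¬ Disjoint (star F z) (star F y)} + 1 ≤ ∑ e ∈ star F y, #e := by
  set N : Finset α := {z ∈ cubic F | ¬ Disjoint (star F z) (star F y)} with hN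
  have hy3 := mem_cubic.1 hy
  have hyN : y ∈ N := by
    refine mem_filter.2 ⟨hy, ?_⟩
    rw [disjoint_self_iff_empty, ← card_eq_zero]
    omega
  have hss : ∀ z, star (star F y) z = star F y ∩ star F z := by
    intro z
    ext e
    simp only [mem_star, mem_inter]
    tauto
  have h3 : ∑ e ∈ star F y, #(N ∩ e) ≤ ∑ e ∈ star F y, #e :=
    sum_le_sum fun e _ => card_le_card inter_subset_right
  rw [sum_card_inter_eq_sum_card_star, ← sum_erase_add _ _ hyN, hss, inter_self, hy3] at h3
  have h4 : #(N.erase y) • 2 ≤ ∑ z ∈ N.erase y, #(star (star F y) z) := by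
    refine card_nsmul_le_sum _ _ _ fun z hz => ?_
    obtain ⟨hzc, hzd⟩ := mem_filter.1 (mem_of_mem_erase hz)
    rw [hss]
    exact h2 y hy z hzc hzd
  have h5 := card_erase_add_one hyN
  simp only [smul_eq_mul] at h4
  omega

/-- A maximal set of vertices of degree three with disjoint stars. -/
lemma exists_maximal_disjoint_cubic (F : Finset (Finset α)) :
    ∃ Y ⊆ cubic F, (Y : Set α).PairwiseDisjoint (star F) ∧
      ∀ z ∈ cubic F, ∃ y ∈ Y, ¬ Disjoint (star F z) (star F y) := by
  classical
  let P : Finset (Finset α) :=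
    {Y ∈ (cubic F).powerset | (Y : Set α).PairwiseDisjoint (star F)}
  have hP : P.Nonempty := ⟨∅, by simp [P]⟩
  obtain ⟨Y, hY, hmax⟩ := exists_max_image P card hP
  obtain ⟨hYc, hYd⟩ : Y ⊆ cubic F ∧ (Y : Set α).PairwiseDisjoint (star F) := by
    simpa [P] using hY
  refine ⟨Y, hYc, hYd, fun z hz => ?_⟩
  by_contra! h
  have hzY : z ∉ Y := by
    intro hzY
    have h1 := h z hzY
    rw [disjoint_self_iff_empty, ← card_eq_zero, mem_cubic.1 hz] at h1
    omega
  have hmem : insert z Y ∈ P := by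
    simp only [P, mem_filter, mem_powerset]
    refine ⟨insert_subset hz hYc, ?_⟩
    rw [coe_insert]
    exact hYd.insert fun y hy _ => h y hy
  have := hmax _ hmem
  rw [card_insert_of_notMem hzY] at this
  omega

/-- The remaining case for edges of size at least five: take a maximal set `Y` of vertices of degree
three with disjoint stars, each with a neighbor, and one vertex for each missed edge. -/
lemma exists_covers_five_of_card_star_le_three (hk : ∀ e ∈ F, 5 ≤ #e) (hF : Admissible F R)
    (hd : ∀ x, #(star F x) ≤ 3)
    (h2 : ∀ y ∈ cubic F, ∀ z ∈ cubic F, ¬ Disjoint (star F z) (star F y) →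
      2 ≤ #(star F y ∩ star F z)) :
    ∃ T, Covers F R T ∧ 7 * #T ≤ 2 * (#(support F) + #F) := by
  obtain ⟨Y, hYc, hYd, hmax⟩ := exists_maximal_disjoint_cubic F
  have hk2 : ∀ e ∈ F, 2 ≤ #e := fun e he => (hk e he).trans' (by norm_num)
  have hnb : ∀ y, ∃ z, y ∈ Y → Joined F y z := by
    intro y
    by_cases hy : y ∈ Y
    · obtain ⟨e, he⟩ : (star F y).Nonempty :=
        card_pos.1 (by rw [mem_cubic.1 (hYc hy)]; norm_num)
      obtain ⟨heF, hye⟩ := mem_star.1 he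
      obtain ⟨z, hze, hzy⟩ := exists_mem_ne (hk2 e heF) y
      exact ⟨z, fun _ => ⟨hzy, e, heF, hye, hze⟩⟩
    · exact ⟨y, fun h => absurd h hy⟩
  choose nb hnb using hnb
  let S := Y ∪ Y.image nb
  have hS : Anchored F R S := by
    intro x hx
    right
    rcases mem_union.1 hx with hx | hx
    · exact ⟨nb x, mem_union_right _ (mem_image_of_mem _ hx), hnb x hx⟩
    · obtain ⟨y, hy, rfl⟩ := mem_image.1 hx
      exact ⟨y, mem_union_left _ hy, (hnb y hy).symm⟩
  have hSc : #S ≤ #Y + #Y := (card_union_le _ _).trans (Nat.add_le_add_left card_image_le _)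
  obtain ⟨T, hT, hTc⟩ := hS.exists_covers hk2 hF
  refine ⟨T, hT, ?_⟩
  set B := Y.biUnion (star F) with hB
  have hBc : #B = 3 * #Y := by
    rw [card_biUnion hYd, sum_congr rfl fun y hy => mem_cubic.1 (hYc hy), sum_const, smul_eq_mul,
      mul_comm]
  have hBhit : #B ≤ #(hit F S) :=
    card_le_card (biUnion_subset.2 fun y hy => star_subset_hit (mem_union_left _ hy))
  have hBF : B ⊆ F := biUnion_subset.2 fun y _ => star_subset
  have hm := card_hit_add_card_missed F S
  -- every vertex of degree three shares an edge with a vertex of `Y`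
  have hcub : 2 * #(cubic F) + #Y ≤ ∑ e ∈ B, #e := by
    have h1 : #(cubic F) ≤ ∑ y ∈ Y, #{z ∈ cubic F | ¬ Disjoint (star F z) (star F y)} := by
      refine (card_le_card fun z hz => ?_).trans card_biUnion_le
      obtain ⟨y, hy, hyz⟩ := hmax z hz
      exact mem_biUnion.2 ⟨y, hy, mem_filter.2 ⟨hz, hyz⟩⟩
    calc 2 * #(cubic F) + #Y
        ≤ 2 * ∑ y ∈ Y, #{z ∈ cubic F | ¬ Disjoint (star F z) (star F y)} + #Y := by omega
      _ = ∑ y ∈ Y, (2 * #{z ∈ cubic F | ¬ Disjoint (star F z) (star F y)} + 1) := by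
        rw [sum_add_distrib, mul_sum, card_eq_sum_ones]
      _ ≤ ∑ y ∈ Y, ∑ e ∈ star F y, #e :=
        sum_le_sum fun y hy => two_mul_card_cubic_near_add_one_le (hYc hy) h2
      _ = ∑ e ∈ B, #e := (sum_biUnion hYd).symm
  have hsum : ∑ e ∈ F, #e ≤ 2 * #(support F) + #(cubic F) := by
    rw [sum_card_eq_sum_card_star, cubic, card_filter, mul_comm, ← smul_eq_mul, ← sum_const,
      ← sum_add_distrib]
    refine sum_le_sum fun x _ => ?_
    have := hd x
    split_ifs <;> omega
  have h1 := sum_sdiff (f := fun e : Finset α => #e) hBF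
  have h3 : #(F \ B) • 5 ≤ ∑ e ∈ F \ B, #e :=
    card_nsmul_le_sum _ _ _ fun e he => hk e (mem_sdiff.1 he).1
  -- larger edges raise the left side of `hsum` by at least what they allow in `hcub`
  have h4 : #B • 5 ≤ ∑ e ∈ B, #e := card_nsmul_le_sum _ _ _ fun e he => hk e (hBF he)
  have h5 := card_sdiff_add_card_eq_card hBF
  simp only [smul_eq_mul] at h3 h4
  omega

theorem exists_covers_five (F : Finset (Finset α)) (R : Set α) (hk : ∀ e ∈ F, 5 ≤ #e)
    (hF : Admissible F R) : ∃ T, Covers F R T ∧ 7 * #T ≤ 2 * (#(support F) + #F) := by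
  refine exists_covers_of_gains (k := 5) (fun F R hk hF => ?_) F R hk hF
  by_cases hd : ∃ x, 4 ≤ #(star F x)
  · obtain ⟨x, hx⟩ := hd
    obtain ⟨y, hxy, hg⟩ := exists_gains_of_two_le (R := R) (x := x)
      (fun e he => (hk e he).trans' (by norm_num)) (by omega)
    refine Or.inl ⟨_, _, hg, ?_⟩
    rw [card_pair hxy.1.symm]
    omega
  push Not at hd
  by_cases h1 : ∃ y ∈ cubic F, ∃ z ∈ cubic F, #(star F y ∩ star F z) = 1
  · obtain ⟨y, hy, z, hz, hyz⟩ := h1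
    obtain ⟨hj, hg⟩ := gains_of_card_inter_eq_one (R := R) (mem_cubic.1 hy) (mem_cubic.1 hz) hyz
    refine Or.inl ⟨_, _, hg, ?_⟩
    rw [card_pair hj.1.symm]
  push Not at h1
  refine Or.inr (exists_covers_five_of_card_star_le_three hk hF
    (fun x => Nat.le_of_lt_succ (hd x)) fun y hy z hz hyz => ?_)
  have h3 := h1 y hy z hz
  have h4 : #(star F y ∩ star F z) ≠ 0 := by
    rwa [Ne, card_eq_zero, ← disjoint_iff_inter_eq_empty, disjoint_comm]
  omega

end EdgeFamily

namespace Hypergraph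

/-! ### From hypergraphs to families of edges -/

open EdgeFamily Finset

variable {V : Type*} {H : Hypergraph V} {k : ℕ}

/-- A bound for total transversals of edge families with edges of size at least `k` applies to the
hypergraphs of the class for `k`. -/
lemma InClass.mul_totalTransversalNumber_le [DecidableEq V] (h : H.InClass k) {a b : ℕ}
    (hb : ∀ (F : Finset (Finset V)) (R : Set V), (∀ e ∈ F, k ≤ #e) → Admissible F R →
      ∃ T, Covers F R T ∧ a * #T ≤ b * (#(support F) + #F)) :
    a * H.totalTransversalNumber ≤ b * (H.order + H.size) := by
  classical
  let F : Finset (Finset V) := {e ∈ h.finite.toFinset.powerset | (e : Set V) ∈ H.edgeSet}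
  have hF : ∀ e, e ∈ F ↔ (e : Set V) ∈ H.edgeSet := by
    intro e
    simp only [F, mem_filter, mem_powerset, and_iff_right_iff_imp]
    intro he x hx
    exact h.finite.mem_toFinset.2 (H.subset_vertexSet_of_mem_edgeSet' he hx)
  have hlift : ∀ e ∈ H.edgeSet, ∃ f ∈ F, (f : Set V) = e := by
    intro e he
    have hfin : e.Finite := h.finite.subset (H.subset_vertexSet_of_mem_edgeSet' he)
    exact ⟨hfin.toFinset, (hF _).2 (by rwa [hfin.coe_toFinset]), hfin.coe_toFinset⟩
  have hsize : H.size = #F := by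
    have : H.edgeSet = ((↑) : Finset V → Set V) '' (F : Set (Finset V)) := by
      ext e
      refine ⟨fun he => hlift e he, ?_⟩
      rintro ⟨f, hf, rfl⟩
      exact (hF f).1 hf
    rw [size, this, Set.ncard_image_of_injective _ coe_injective, Set.ncard_coe_finset]
  have horder : H.order = #(support F) := by
    have : H.vertexSet = (support F : Set V) := by
      ext x
      rw [mem_coe, mem_support]
      constructor
      · intro hx
        have hx' := h.no_isolated_vertex x hx
        simp only [IsIsolated, not_forall, not_not] at hx'
        obtain ⟨e, he, hxe⟩ := hx'
        obtain ⟨f, hf, rfl⟩ := hlift e he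
        exact ⟨f, hf, hxe⟩
      · rintro ⟨f, hf, hxf⟩
        exact H.subset_vertexSet_of_mem_edgeSet' ((hF f).1 hf) hxf
    rw [order, this, Set.ncard_coe_finset]
  have hadm : Admissible F ∅ := by
    intro e he
    right
    have hiso := h.no_isolated_edge e ((hF e).1 he)
    simp only [IsIsolatedEdge, not_and, not_forall] at hiso
    obtain ⟨f', hf', hne, hinter⟩ := hiso ((hF e).1 he)
    obtain ⟨f, hf, rfl⟩ := hlift f' hf'
    obtain ⟨x, hxe, hxf⟩ := Set.nonempty_iff_ne_empty.2 hinter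
    exact ⟨f, hf, fun hfe => hne (by rw [hfe]), x, hxe, hxf⟩
  obtain ⟨T, ⟨hT1, hT2⟩, hTc⟩ := hb F ∅
    (fun e he => by rw [← Set.ncard_coe_finset, h.uniform _ ((hF e).1 he)]) hadm
  have hjoin : ∀ x ∈ T, ∃ y ∈ T, Joined F x y := fun x hx => (hT2 x hx).resolve_left id
  have htot : H.IsTotalTransversal (T : Set V) := by
    refine ⟨⟨fun x hx => ?_, fun e he => ?_⟩, fun x hx => ?_⟩
    · obtain ⟨y, -, -, e, he, hxe, -⟩ := hjoin x hx
      exact H.subset_vertexSet_of_mem_edgeSet' ((hF e).1 he) hxe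
    · obtain ⟨f, hf, rfl⟩ := hlift e he
      obtain ⟨x, hxf, hxT⟩ := not_disjoint_iff.1 (hT1 f hf)
      exact ⟨x, hxT, hxf⟩
    · obtain ⟨y, hy, hne, e, he, hxe, hye⟩ := hjoin x hx
      exact ⟨y, hy, hne, e, (hF e).1 he, hxe, hye⟩
  rw [horder, hsize]
  have hle : H.totalTransversalNumber ≤ #T := Nat.sInf_le ⟨T, htot, rfl⟩
  exact (Nat.mul_le_mul_left _ hle).trans hTc

lemma InClass.order_pos (h : H.InClass k) : 0 < H.order :=
  (Set.ncard_pos h.finite).2 h.nonempty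

lemma le_of_mem_ratioSet {a b : ℕ} (ha : 0 < a) {r : ℝ} (hr : r ∈ ratioSet k)
    (hb : ∀ (V : Type) [DecidableEq V] (F : Finset (Finset V)) (R : Set V), (∀ e ∈ F, k ≤ #e) →
      Admissible F R → ∃ T, Covers F R T ∧ a * #T ≤ b * (#(support F) + #F)) :
    r ≤ b / a := by
  classical
  obtain ⟨V, H, h, rfl⟩ := hr
  have h1 : (a : ℝ) * H.totalTransversalNumber ≤ b * (H.order + H.size) := by
    exact_mod_cast h.mul_totalTransversalNumber_le (hb V)
  have h2 : (0 : ℝ) < H.order := by exact_mod_cast h.order_pos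
  rw [totalTransversalRatio, div_le_div_iff₀ (by positivity) (by exact_mod_cast ha)]
  linarith

lemma le_two_fifths_of_mem_ratioSet (hk : 2 ≤ k) {r : ℝ} (hr : r ∈ ratioSet k) : r ≤ 2 / 5 := by
  exact_mod_cast le_of_mem_ratioSet (a := 5) (b := 2) (by norm_num) hr
    fun V _ F R hF => exists_covers_two F R fun e he => hk.trans (hF e he)

lemma le_third_of_mem_ratioSet (hk : 3 ≤ k) {r : ℝ} (hr : r ∈ ratioSet k) : r ≤ 1 / 3 := by
  exact_mod_cast le_of_mem_ratioSet (a := 3) (b := 1) (by norm_num) hr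
    fun V _ F R hF => exists_covers_three F R fun e he => hk.trans (hF e he)

lemma le_two_sevenths_of_mem_ratioSet (hk : 5 ≤ k) {r : ℝ} (hr : r ∈ ratioSet k) :
    r ≤ 2 / 7 := by
  exact_mod_cast le_of_mem_ratioSet (a := 7) (b := 2) (by norm_num) hr
    fun V _ F R hF => exists_covers_five F R fun e he => hk.trans (hF e he)

/-! ### Members of the class -/

/-- The hypergraph on `k + 1` vertices whose edges are all sets of `k` vertices. -/
def coSingletons (k : ℕ) : Hypergraph (Fin (k + 1)) where
  vertexSet := Set.univ
  edgeSet := {e | ∃ i, e = {i}ᶜ}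
  subset_vertexSet_of_mem_edgeSet' := fun e _ => Set.subset_univ e

lemma coSingletons_inClass (hk : 2 ≤ k) : (coSingletons k).InClass k where
  nonempty := Set.univ_nonempty
  finite := Set.finite_univ
  uniform := by
    rintro e ⟨i, rfl⟩
    rw [Set.ncard_compl, Set.ncard_singleton, Nat.card_fin, Nat.add_sub_cancel]
  no_isolated_vertex := by
    intro v _ h
    have : Nontrivial (Fin (k + 1)) := Fin.nontrivial_iff_two_le.2 (by omega)
    obtain ⟨i, hi⟩ := exists_ne v
    exact h {i}ᶜ ⟨i, rfl⟩ hi.symm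
  no_isolated_edge := by
    rintro e - ⟨⟨i, rfl⟩, h⟩
    have : Nontrivial (Fin (k + 1)) := Fin.nontrivial_iff_two_le.2 (by omega)
    obtain ⟨j, hj⟩ := exists_ne i
    obtain ⟨l, hl⟩ : ∃ l : Fin (k + 1), l ∉ ({i, j} : Finset (Fin (k + 1))) := by
      by_contra! hall
      have h1 : #(univ : Finset (Fin (k + 1))) ≤ #{i, j} := card_le_card fun l _ => hall l
      have h2 : #({i, j} : Finset (Fin (k + 1))) ≤ 2 := card_le_two
      rw [card_univ, Fintype.card_fin] at h1
      omega
    simp only [mem_singleton, mem_insert, not_or] at hl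
    have hne : ({j}ᶜ : Set (Fin (k + 1))) ≠ {i}ᶜ := fun h =>
      hj (Set.singleton_injective (compl_injective h))
    have := h {j}ᶜ ⟨j, rfl⟩ hne
    exact Set.notMem_empty l (this ▸ ⟨hl.1, hl.2⟩)

/-- As soon as there is an edge, a total transversal contains a vertex and a neighbor of it, so one
with two vertices is optimal. -/
lemma totalTransversalNumber_eq_two {x y : V} (hxy : x ≠ y) (hne : H.edgeSet.Nonempty)
    (h : H.IsTotalTransversal {x, y}) : H.totalTransversalNumber = 2 := by
  classical
  have hmem : 2 ∈ {n : ℕ | ∃ T : Finset V, H.IsTotalTransversal (T : Set V) ∧ T.card = n} :=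
    ⟨{x, y}, by simpa using h, card_pair hxy⟩
  refine le_antisymm (Nat.sInf_le hmem) (le_csInf ⟨2, hmem⟩ ?_)
  rintro n ⟨T, hT, rfl⟩
  obtain ⟨e, he⟩ := hne
  obtain ⟨u, hu, -⟩ := hT.1.2 e he
  obtain ⟨w, hw, hwu, -⟩ := hT.2 u hu
  exact one_lt_card.2 ⟨w, hw, u, hu, hwu⟩

lemma pathThree_edges_ne : ({0, 1} : Set (Fin 3)) ≠ {1, 2} := by
  intro h
  have : (0 : Fin 3) ∈ ({1, 2} : Set (Fin 3)) := h ▸ by simp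
  simp at this

lemma twoTriples_edges_ne : ({0, 1, 2} : Set (Fin 4)) ≠ {1, 2, 3} := by
  intro h
  have : (0 : Fin 4) ∈ ({1, 2, 3} : Set (Fin 4)) := h ▸ by simp
  simp at this

lemma pathThree_inClass : pathThree.InClass 2 where
  nonempty := Set.univ_nonempty
  finite := Set.finite_univ
  uniform := by
    rintro e (rfl | rfl) <;> exact Set.ncard_pair (by decide)
  no_isolated_vertex := by
    intro v _ h
    have h1 := h {0, 1} (Or.inl rfl)
    have h2 := h {1, 2} (Or.inr rfl)
    fin_cases v <;> simp at h1 h2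
  no_isolated_edge := by
    rintro e - ⟨rfl | rfl, h⟩
    · exact Set.notMem_empty (1 : Fin 3)
        (h _ (Or.inr rfl) pathThree_edges_ne.symm ▸ ⟨by simp, by simp⟩)
    · exact Set.notMem_empty (1 : Fin 3)
        (h _ (Or.inl rfl) pathThree_edges_ne ▸ ⟨by simp, by simp⟩)

lemma twoTriples_inClass : twoTriples.InClass 3 where
  nonempty := Set.univ_nonempty
  finite := Set.finite_univ
  uniform := by
    rintro e (rfl | rfl) <;>
      exact Set.ncard_eq_three.2 ⟨_, _, _, by decide, by decide, by decide, rfl⟩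
  no_isolated_vertex := by
    intro v _ h
    have h1 := h {0, 1, 2} (Or.inl rfl)
    have h2 := h {1, 2, 3} (Or.inr rfl)
    fin_cases v <;> simp at h1 h2
  no_isolated_edge := by
    rintro e - ⟨rfl | rfl, h⟩
    · exact Set.notMem_empty (1 : Fin 4)
        (h _ (Or.inr rfl) twoTriples_edges_ne.symm ▸ ⟨by simp, by simp⟩)
    · exact Set.notMem_empty (1 : Fin 4)
        (h _ (Or.inl rfl) twoTriples_edges_ne ▸ ⟨by simp, by simp⟩)

lemma pathThree_totalTransversalRatio : pathThree.totalTransversalRatio = 2 / 5 := by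
  have h1 : pathThree.totalTransversalNumber = 2 := by
    refine totalTransversalNumber_eq_two (x := 0) (y := 1) (by decide) ⟨_, Or.inl rfl⟩
      ⟨⟨Set.subset_univ _, ?_⟩, ?_⟩
    · rintro e (rfl | rfl) <;> exact ⟨1, by simp⟩
    · rintro x (rfl | rfl)
      · exact ⟨1, by simp, by decide, _, Or.inl rfl, by simp, by simp⟩
      · exact ⟨0, by simp, by decide, _, Or.inl rfl, by simp, by simp⟩
  have h2 : pathThree.order = 3 := by simp [order, pathThree, Set.ncard_univ]
  have h3 : pathThree.size = 2 := Set.ncard_pair pathThree_edges_ne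
  rw [totalTransversalRatio, h1, h2, h3]
  norm_num

lemma twoTriples_totalTransversalRatio : twoTriples.totalTransversalRatio = 1 / 3 := by
  have h1 : twoTriples.totalTransversalNumber = 2 := by
    refine totalTransversalNumber_eq_two (x := 0) (y := 1) (by decide) ⟨_, Or.inl rfl⟩
      ⟨⟨Set.subset_univ _, ?_⟩, ?_⟩
    · rintro e (rfl | rfl) <;> exact ⟨1, by simp⟩
    · rintro x (rfl | rfl)
      · exact ⟨1, by simp, by decide, _, Or.inl rfl, by simp, by simp⟩
      · exact ⟨0, by simp, by decide, _, Or.inl rfl, by simp, by simp⟩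
  have h2 : twoTriples.order = 4 := by simp [order, twoTriples, Set.ncard_univ]
  have h3 : twoTriples.size = 2 := Set.ncard_pair twoTriples_edges_ne
  rw [totalTransversalRatio, h1, h2, h3]
  norm_num

lemma ratioSet_nonempty (hk : 2 ≤ k) : (ratioSet k).Nonempty :=
  ⟨_, _, _, coSingletons_inClass hk, rfl⟩

end Hypergraph

theorem theorem2 :
    (∀ k : ℕ, 2 ≤ k → (Hypergraph.ratioSet k).Nonempty ∧ BddAbove (Hypergraph.ratioSet k)) ∧
    Hypergraph.b 2 = 2 / 5 ∧
    Hypergraph.b 3 = 1 / 3 ∧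
    Hypergraph.b 4 ≤ 1 / 3 ∧
    (∀ k : ℕ, 5 ≤ k → Hypergraph.b k ≤ 2 / 7) ∧
    (Hypergraph.pathThree.InClass 2 ∧ Hypergraph.pathThree.totalTransversalRatio = 2 / 5) ∧
    (Hypergraph.twoTriples.InClass 3 ∧ Hypergraph.twoTriples.totalTransversalRatio = 1 / 3) := by
  open Hypergraph in
  refine ⟨fun k hk => ⟨ratioSet_nonempty hk, 2 / 5, fun r => le_two_fifths_of_mem_ratioSet hk⟩,
    ?_, ?_, ?_, ?_, ⟨pathThree_inClass, pathThree_totalTransversalRatio⟩,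
    ⟨twoTriples_inClass, twoTriples_totalTransversalRatio⟩⟩
  · exact IsGreatest.csSup_eq ⟨⟨_, _, pathThree_inClass, pathThree_totalTransversalRatio⟩,
      fun r => le_two_fifths_of_mem_ratioSet le_rfl⟩
  · exact IsGreatest.csSup_eq ⟨⟨_, _, twoTriples_inClass, twoTriples_totalTransversalRatio⟩,
      fun r => le_third_of_mem_ratioSet le_rfl⟩
  · exact csSup_le (ratioSet_nonempty (by norm_num))
      fun r => le_third_of_mem_ratioSet (by norm_num)
  · exact fun k hk => csSup_le (ratioSet_nonempty (by omega))
      fun r => le_two_sevenths_of_mem_ratioSet hk
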